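/- Let $\alpha\in(0,2)$ and let $\{Y_j\}_{j\in\mathbb Z}$ be independent, identically distributed real random variables such that $$P(|Y_j|>x)=x^{-\alpha}h(x),\qquad x>0,$$ where $h$ varies slowly at $+\infty$ (i.e. $h$ is positive and measurable near $+\infty$ and $h(rx)/h(x)\to1$ as $x\to\infty$ for every $r>0$). Assume moreover that $E[Y_j]=0$ if $\alpha>1$, and that $Y_j$ is symmetric (i.e. $-Y_j$ and $Y_j$ have the same law) if $\alpha=1$. Let $\{c_{n,j}:n\in\mathbb N,\ j\in\mathbb Z\}$ be an array of real numbers such that for each $n$ $$\sum_{j\in\mathbb Z}|c_{n,j}|^{\alpha}h(|c_{n,j}|^{-1})<+\infty,$$ where terms with $c_{n,j}=0$ are read as $0$. Then for each $n$ the series $V_n=\sum_{j\in\mathbb Z}c_{n,j}Y_j$ converges almost surely (in the sense that $\sum_{j=M}^{N}c_{n,j}Y_j$ converges as $M\to-\infty$ and $N\to\infty$ independently), and $$V_n\to0\ \text{ in probability as } n\to\infty\quad\text{if and only if}\quad \sum_{j\in\mathbb Z}|c_{n,j}|^{\alpha}h(|c_{n,j}|^{-1})\to0\ \text{ as } n\to\infty.$$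 -/

import Mathlib

open Set Filter Topology MeasureTheory ProbabilityTheory

/-- `h` varies slowly at `+∞`: it is positive and measurable on some half-line `[X, ∞)`, and
`h (r x) / h x → 1` as `x → ∞`, for every `r > 0`. -/
def SlowlyVaryingAtTop (h : ℝ → ℝ) : Prop :=
  (∃ X : ℝ, (∀ x ∈ Ici X, 0 < h x) ∧ Measurable (fun x : Ici X => h x)) ∧
    ∀ r : ℝ, 0 < r → Tendsto (fun x : ℝ => h (r * x) / h x) atTop (𝓝 1)

/-- The two-sided random series `∑_{j ∈ ℤ} c j * Y j ω`, understood as the limit of the partial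
sums over `{M, …, N}` as `M → -∞` and `N → ∞` independently of each other. (These series are
in general not absolutely convergent.) -/
noncomputable def linearSeries {Ω : Type*} (c : ℤ → ℝ) (Y : ℤ → Ω → ℝ) (ω : Ω) : ℝ :=
  ∑'[SummationFilter.conditional ℤ] j : ℤ, c j * Y j ω

/-!
Let `ν` be the common law of the `Y j` and `p t = ν {y | 1 < |t * y|}`. The tail hypothesis says
that `|c| ^ α * h |c|⁻¹ = p c`, also for `c = 0`, so the sums in the statement are
`∑ j, P (|c n j * Y j| > 1)`, and slow variation is used only through the unboundedness of the
support and the limit `2 ^ (-α)` of the dyadic tail ratio (`HasTailIndex`).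

*Domination by the tail.* Let `truncOne` truncate at level `1`. A dyadic form of Karamata's
theorem bounds `E (truncOne (t Y)) ^ 2` and `|E truncOne (t Y)|` by `K * p t` for every real `t`
(`HasTailIndex.integral_abs_truncOne_pow_le`, `HasTailIndex.abs_integral_truncOne_le`). For small
`t` this is regular variation, combined with `E Y = 0` if `α > 1` and with symmetry if `α = 1`; for
large `t` it holds because `p` is bounded below there.

*Convergence and sufficiency.* Summability of `p (c j)` thus gives all three series of Kolmogorov's
theorem, whose sufficient half follows from martingale convergence and the Borel-Cantelli lemma
(`ae_summable_conditional_of_three_series`). The same bounds and Chebyshev's inequality give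
`P (|V| ≥ ε) ≤ b + (K b + (K b) ^ 2) / ε ^ 2` with `b = ∑ j, p (c j)`
(`IsTailDominated.measure_le_abs_linearSeries_le`).

*Necessity.* If `V` is close to `0` in probability, then its characteristic function is close to
`1` uniformly on `[-1, 1]`, and it is dominated by each finite part of the product of those of the
terms. Hence `∑ j, (1 - |φ (u * c j)| ^ 2)` is small uniformly in `|u| ≤ 1`, where `φ` is the
characteristic function of `ν` (`sum_one_sub_norm_charFun_sq_le`). By symmetrization
`κ * p t ≤ 1 - |φ t| ^ 2` for `|t| ≤ t₀`
(`HasTailIndex.scaledTail_le_one_sub_norm_charFun_sq`). A coefficient with `|c j| > t₀` is excluded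
by the choice `u = t₀ / |c j|`, after which `u = 1` bounds `∑ j, p (c j)`.
-/

/-! ### Laws with a tail of index `-α` -/

/-- The two-sided tail `x ↦ ν {|y| > x}` of a measure on the line. -/
noncomputable def absTail (ν : Measure ℝ) (x : ℝ) : ℝ := ν.real {y | x < |y|}

/-- A law with unbounded support whose two-sided tail `T` satisfies `T (2x) / T x → 2 ^ (-α)`.
This dyadic form of regular variation of index `-α` is all that the estimates below use. -/
structure HasTailIndex (ν : Measure ℝ) (α : ℝ) : Prop where
  pos : ∀ x, 0 < x → 0 < absTail ν x
  ratio : Tendsto (fun x => absTail ν (2 * x) / absTail ν x) atTop (𝓝 ((2 : ℝ) ^ (-α)))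

/-- The probability that `t * y` exceeds `1` in absolute value when `y` has law `ν`. -/
noncomputable def scaledTail (ν : Measure ℝ) (t : ℝ) : ℝ := ν.real {y | 1 < |t * y|}

/-- Truncation at level `1`: values outside `[-1, 1]` are replaced by `0`. -/
noncomputable def truncOne (y : ℝ) : ℝ := if |y| ≤ 1 then y else 0

lemma measurable_truncOne : Measurable truncOne :=
  Measurable.ite (measurableSet_le measurable_id.abs measurable_const) measurable_id
    measurable_const

lemma abs_truncOne_le (y : ℝ) : |truncOne y| ≤ 1 := by
  unfold truncOne
  split_ifs with h
  · exact h
  · simp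

lemma truncOne_neg (y : ℝ) : truncOne (-y) = -truncOne y := by
  unfold truncOne
  rw [abs_neg]
  split_ifs <;> simp

lemma scaledTail_nonneg (ν : Measure ℝ) (t : ℝ) : 0 ≤ scaledTail ν t := measureReal_nonneg

lemma scaledTail_zero (ν : Measure ℝ) : scaledTail ν 0 = 0 := by
  simp [scaledTail, not_lt.2 zero_le_one]

lemma one_lt_abs_mul_iff {t : ℝ} (ht : t ≠ 0) (y : ℝ) : 1 < |t * y| ↔ |t|⁻¹ < |y| := by
  rw [abs_mul, inv_lt_iff_one_lt_mul₀' (abs_pos.2 ht)]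

lemma scaledTail_eq_absTail (ν : Measure ℝ) {t : ℝ} (ht : t ≠ 0) :
    scaledTail ν t = absTail ν |t|⁻¹ := by
  unfold scaledTail absTail
  simp_rw [one_lt_abs_mul_iff ht]

lemma measurableSet_lt_abs (x : ℝ) : MeasurableSet {y : ℝ | x < |y|} :=
  measurableSet_lt measurable_const measurable_id.abs

lemma measurableSet_abs_le (x : ℝ) : MeasurableSet {y : ℝ | |y| ≤ x} :=
  measurableSet_le measurable_id.abs measurable_const

lemma absTail_nonneg {ν : Measure ℝ} (x : ℝ) : 0 ≤ absTail ν x := measureReal_nonneg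

section Tail

variable {ν : Measure ℝ} [IsProbabilityMeasure ν] {α : ℝ}

lemma absTail_antitone : Antitone (absTail ν) := fun _ _ h =>
  measureReal_mono fun _ hy => lt_of_le_of_lt h hy

/-- A bound by the scaled tail only has to be checked for small scales, where regular variation
applies: at larger scales the scaled tail is bounded below. -/
lemma HasTailIndex.le_scaledTail_of_small (hν : HasTailIndex ν α) {F : ℝ → ℝ}
    (hF0 : F 0 ≤ 0) (hF1 : ∀ t, F t ≤ 1) {C X : ℝ} (hX : 0 < X)
    (hF : ∀ t, t ≠ 0 → X ≤ |t|⁻¹ → F t ≤ C * absTail ν |t|⁻¹) :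
    ∃ K, ∀ t, F t ≤ K * scaledTail ν t := by
  have hTX := hν.pos X hX
  refine ⟨max |C| (absTail ν X)⁻¹, fun t => ?_⟩
  rcases eq_or_ne t 0 with rfl | ht
  · simpa [scaledTail_zero] using hF0
  rw [scaledTail_eq_absTail ν ht]
  rcases le_total X |t|⁻¹ with h | h
  · refine (hF t ht h).trans ?_
    gcongr
    · exact absTail_nonneg _
    · exact (le_abs_self C).trans (le_max_left _ _)
  · calc F t ≤ 1 := hF1 t
      _ = (absTail ν X)⁻¹ * absTail ν X := by field_simp
      _ ≤ max |C| (absTail ν X)⁻¹ * absTail ν |t|⁻¹ := by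
          gcongr
          · exact le_max_right _ _
          · exact absTail_antitone h

lemma integrableOn_abs_pow (β : ℕ) (x : ℝ) :
    IntegrableOn (fun y : ℝ => |y| ^ β) {y | |y| ≤ x} ν := by
  refine Measure.integrableOn_of_bounded (M := |x| ^ β) (by finiteness)
    (by fun_prop) ?_
  refine (ae_restrict_mem (measurableSet_abs_le x)).mono fun y hy => ?_
  simp only [norm_pow, Real.norm_eq_abs, abs_abs]
  exact pow_le_pow_left₀ (abs_nonneg _) (le_trans hy (le_abs_self x)) _

/-- Splitting off the last dyadic block of a truncated moment. -/
lemma setIntegral_abs_pow_two_mul_le (β : ℕ) {x : ℝ} (hx : 0 ≤ x) :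
    ∫ y in {y | |y| ≤ 2 * x}, |y| ^ β ∂ν ≤
      ∫ y in {y | |y| ≤ x}, |y| ^ β ∂ν + (2 * x) ^ β * absTail ν x := by
  have hU : {y : ℝ | |y| ≤ 2 * x} = {y | |y| ≤ x} ∪ {y | x < |y| ∧ |y| ≤ 2 * x} := by
    ext y
    simp only [mem_ofPred_eq, mem_union]
    grind
  have hm : MeasurableSet {y : ℝ | x < |y| ∧ |y| ≤ 2 * x} :=
    (measurableSet_lt_abs x).inter (measurableSet_abs_le _)
  have hint := integrableOn_abs_pow (ν := ν) β (2 * x)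
  rw [hU] at hint
  rw [hU, setIntegral_union ?_ hm hint.left_of_union hint.right_of_union]
  · gcongr
    have h1 : ∀ y ∈ {y : ℝ | x < |y| ∧ |y| ≤ 2 * x}, ‖|y| ^ β‖ ≤ (2 * x) ^ β := by
      intro y hy
      rw [norm_pow, Real.norm_eq_abs, abs_abs]
      exact pow_le_pow_left₀ (abs_nonneg _) hy.2 _
    refine (le_abs_self _).trans ((norm_setIntegral_le_of_norm_le_const (by finiteness) h1).trans ?_)
    gcongr
    exact measureReal_mono fun y hy => hy.1
  · rw [Set.disjoint_left]
    intro y hy hy'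
    exact absurd hy'.1 (not_lt.2 hy)

/-- Karamata's estimate for truncated moments of order `β > α`. -/
lemma HasTailIndex.setIntegral_abs_pow_le (hν : HasTailIndex ν α) {β : ℕ} (hβ : α < β) :
    ∃ C X : ℝ, 0 < X ∧ ∀ x, X ≤ x →
      ∫ y in {y | |y| ≤ x}, |y| ^ β ∂ν ≤ C * x ^ β * absTail ν x := by
  have hlt : ((2 : ℝ) ^ β)⁻¹ < (2 : ℝ) ^ (-α) := by
    rw [← Real.rpow_natCast, ← Real.rpow_neg zero_le_two]
    exact Real.rpow_lt_rpow_of_exponent_lt one_lt_two (by linarith)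
  obtain ⟨q, hq1, hq2⟩ := exists_between hlt
  obtain ⟨X, hX⟩ := eventually_atTop.1 ((hν.ratio.eventually_const_lt hq2).and
    (eventually_gt_atTop 0))
  have hX0 : 0 < X := (hX X le_rfl).2
  have hstep : ∀ x, X ≤ x → q * absTail ν x ≤ absTail ν (2 * x) := fun x hx =>
    ((lt_div_iff₀ (hν.pos x (hX x hx).2)).1 (hX x hx).1).le
  have h2 : (0 : ℝ) < 2 ^ β := by positivity
  have hr : 0 < 2 ^ β * q - 1 := by
    have := mul_lt_mul_of_pos_left hq1 h2
    rw [mul_inv_cancel₀ h2.ne'] at this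
    linarith
  -- the second entry makes the dyadic recursion stable, the first one covers `[X, 2X]`
  set K := max (absTail ν (2 * X))⁻¹ (2 ^ β / (2 ^ β * q - 1)) with hK
  have hT2 : 0 < absTail ν (2 * X) := hν.pos _ (by positivity)
  have hK0 : 0 < K := lt_max_of_lt_left (by positivity)
  have hK1 : 1 ≤ K * absTail ν (2 * X) := by
    have := le_max_left (absTail ν (2 * X))⁻¹ (2 ^ β / (2 ^ β * q - 1))
    rw [← hK] at this
    calc (1 : ℝ) = (absTail ν (2 * X))⁻¹ * absTail ν (2 * X) := by field_simp
      _ ≤ _ := by gcongr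
  have hK2 : K + 2 ^ β ≤ K * 2 ^ β * q := by
    have := le_max_right (absTail ν (2 * X))⁻¹ (2 ^ β / (2 ^ β * q - 1))
    rw [← hK, div_le_iff₀ hr] at this
    linarith
  refine ⟨K, X, hX0, ?_⟩
  have key : ∀ k : ℕ, ∀ x, X ≤ x → x ≤ 2 * 2 ^ k * X →
      ∫ y in {y | |y| ≤ x}, |y| ^ β ∂ν ≤ K * x ^ β * absTail ν x := by
    have base : ∀ x, X ≤ x → x ≤ 2 * X →
        ∫ y in {y | |y| ≤ x}, |y| ^ β ∂ν ≤ K * x ^ β * absTail ν x := by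
      intro x hx hx2
      have hx0 : 0 ≤ x := hX0.le.trans hx
      have h1 : ∀ y ∈ {y : ℝ | |y| ≤ x}, ‖|y| ^ β‖ ≤ x ^ β := by
        intro y hy
        rw [norm_pow, Real.norm_eq_abs, abs_abs]
        exact pow_le_pow_left₀ (abs_nonneg _) hy _
      calc ∫ y in {y | |y| ≤ x}, |y| ^ β ∂ν ≤ x ^ β * ν.real {y | |y| ≤ x} :=
            (le_abs_self _).trans (norm_setIntegral_le_of_norm_le_const (by finiteness) h1)
        _ ≤ x ^ β * 1 := by gcongr; exact measureReal_le_one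
        _ ≤ x ^ β * (K * absTail ν (2 * X)) := by gcongr
        _ ≤ x ^ β * (K * absTail ν x) := by gcongr; exact absTail_antitone hx2
        _ = K * x ^ β * absTail ν x := by ring
    intro k
    induction k with
    | zero => intro x hx hx2; exact base x hx (by simpa using hx2)
    | succ k ih =>
      intro x hx hx2
      rcases le_total x (2 * X) with h | h
      · exact base x hx h
      obtain ⟨z, rfl⟩ : ∃ z, x = 2 * z := ⟨x / 2, by ring⟩
      have hz : X ≤ z := by linarith
      have hz0 : 0 ≤ z := hX0.le.trans hz
      have hz2 : z ≤ 2 * 2 ^ k * X := by rw [pow_succ] at hx2; linarith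
      have hTz : 0 ≤ z ^ β * absTail ν z := mul_nonneg (by positivity) (absTail_nonneg _)
      calc ∫ y in {y | |y| ≤ 2 * z}, |y| ^ β ∂ν
          ≤ K * z ^ β * absTail ν z + (2 * z) ^ β * absTail ν z :=
            (setIntegral_abs_pow_two_mul_le β hz0).trans (by gcongr; exact ih z hz hz2)
        _ = (K + 2 ^ β) * (z ^ β * absTail ν z) := by rw [mul_pow]; ring
        _ ≤ (K * 2 ^ β * q) * (z ^ β * absTail ν z) := by gcongr
        _ = K * (2 * z) ^ β * (q * absTail ν z) := by rw [mul_pow]; ring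
        _ ≤ K * (2 * z) ^ β * absTail ν (2 * z) := by gcongr; exact hstep z hz
  intro x hx
  obtain ⟨k, hk⟩ := pow_unbounded_of_one_lt (x / X) one_lt_two
  refine key k x hx ?_
  rw [div_lt_iff₀ hX0] at hk
  have : (0 : ℝ) < 2 ^ k * X := by positivity
  linarith

/-- The part of the first absolute moment beyond `x`, for `α > 1`. -/
lemma HasTailIndex.setIntegral_abs_tail_le (hν : HasTailIndex ν α) (hα : 1 < α) :
    ∃ C X : ℝ, 0 < X ∧ ∀ x, X ≤ x → IntegrableOn (fun y : ℝ => |y|) {y | x < |y|} ν ∧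
      ∫ y in {y | x < |y|}, |y| ∂ν ≤ C * x * absTail ν x := by
  have hlt : (2 : ℝ) ^ (-α) < 1 / 2 := by
    calc (2 : ℝ) ^ (-α) < 2 ^ (-1 : ℝ) :=
          Real.rpow_lt_rpow_of_exponent_lt one_lt_two (by linarith)
      _ = 1 / 2 := by rw [Real.rpow_neg_one]; norm_num
  obtain ⟨q, hq1, hq2⟩ := exists_between hlt
  obtain ⟨X, hX⟩ := eventually_atTop.1 ((hν.ratio.eventually_lt_const hq1).and
    (eventually_gt_atTop 0))
  have hX0 : 0 < X := (hX X le_rfl).2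
  have hstep : ∀ x, X ≤ x → absTail ν (2 * x) ≤ q * absTail ν x := fun x hx =>
    ((div_lt_iff₀ (hν.pos x (hX x hx).2)).1 (hX x hx).1).le
  have hr : 0 < 1 - 2 * q := by linarith
  set K := 2 / (1 - 2 * q) with hK
  have hK0 : 0 < K := by positivity
  have hK2 : K * (2 * q) + 2 = K := by rw [hK]; field_simp; ring
  -- mass of `|y|` on `x < |y| ≤ 2 ^ k x`, bounded uniformly in `k`
  have key : ∀ k : ℕ, ∀ x, X ≤ x →
      ∫⁻ y in {y | x < |y| ∧ |y| ≤ 2 ^ k * x}, ENNReal.ofReal |y| ∂ν ≤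
        ENNReal.ofReal (K * x * absTail ν x) := by
    intro k
    induction k with
    | zero =>
      intro x hx
      have : {y : ℝ | x < |y| ∧ |y| ≤ 2 ^ 0 * x} = ∅ := by
        ext y
        simp
      rw [this]
      simp
    | succ k ih =>
      intro x hx
      have hx0 : 0 < x := hX0.trans_le hx
      have hsub : {y : ℝ | x < |y| ∧ |y| ≤ 2 ^ (k + 1) * x} ⊆
          {y | x < |y| ∧ |y| ≤ 2 * x} ∪ {y | 2 * x < |y| ∧ |y| ≤ 2 ^ k * (2 * x)} := by
        intro y hy
        rcases le_or_gt |y| (2 * x) with h | h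
        · exact Or.inl ⟨hy.1, h⟩
        · refine Or.inr ⟨h, hy.2.trans_eq (by ring)⟩
      have h1 : ∫⁻ y in {y | x < |y| ∧ |y| ≤ 2 * x}, ENNReal.ofReal |y| ∂ν ≤
          ENNReal.ofReal (2 * x * absTail ν x) := by
        calc ∫⁻ y in {y | x < |y| ∧ |y| ≤ 2 * x}, ENNReal.ofReal |y| ∂ν
            ≤ ∫⁻ y in {y | x < |y| ∧ |y| ≤ 2 * x}, ENNReal.ofReal (2 * x) ∂ν :=
              setLIntegral_mono measurable_const fun y hy => ENNReal.ofReal_le_ofReal hy.2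
          _ = ENNReal.ofReal (2 * x) * ν {y | x < |y| ∧ |y| ≤ 2 * x} := setLIntegral_const _ _
          _ ≤ ENNReal.ofReal (2 * x) * ν {y | x < |y|} := by
              gcongr
              exact fun hy => hy.1
          _ = ENNReal.ofReal (2 * x * absTail ν x) := by
              rw [ENNReal.ofReal_mul (p := 2 * x) (by positivity), absTail, ofReal_measureReal]
      calc ∫⁻ y in {y | x < |y| ∧ |y| ≤ 2 ^ (k + 1) * x}, ENNReal.ofReal |y| ∂ν
          ≤ ENNReal.ofReal (2 * x * absTail ν x) +
              ENNReal.ofReal (K * (2 * x) * absTail ν (2 * x)) :=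
            (lintegral_mono_set hsub).trans ((lintegral_union_le _ _ _).trans
              (add_le_add h1 (ih (2 * x) (by linarith))))
        _ = ENNReal.ofReal (2 * x * absTail ν x + K * (2 * x) * absTail ν (2 * x)) :=
            (ENNReal.ofReal_add (mul_nonneg (by positivity) (absTail_nonneg _))
              (mul_nonneg (by positivity) (absTail_nonneg _))).symm
        _ ≤ ENNReal.ofReal (K * x * absTail ν x) := by
            refine ENNReal.ofReal_le_ofReal ?_
            calc 2 * x * absTail ν x + K * (2 * x) * absTail ν (2 * x)
                ≤ 2 * x * absTail ν x + K * (2 * x) * (q * absTail ν x) := by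
                  gcongr; exact hstep x hx
              _ = (K * (2 * q) + 2) * x * absTail ν x := by ring
              _ = K * x * absTail ν x := by rw [hK2]
  refine ⟨K, X, hX0, fun x hx => ?_⟩
  have hx0 : 0 < x := hX0.trans_le hx
  have hle : ∫⁻ y in {y | x < |y|}, ENNReal.ofReal |y| ∂ν ≤
      ENNReal.ofReal (K * x * absTail ν x) := by
    have hU : {y : ℝ | x < |y|} = ⋃ k : ℕ, {y | x < |y| ∧ |y| ≤ 2 ^ k * x} := by
      ext y
      simp only [mem_iUnion, mem_ofPred_eq, exists_and_left]
      refine ⟨fun h => ⟨h, ?_⟩, fun h => h.1⟩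
      obtain ⟨k, hk⟩ := pow_unbounded_of_one_lt (|y| / x) one_lt_two
      exact ⟨k, ((div_lt_iff₀ hx0).1 hk).le⟩
    have hmono : Monotone fun k : ℕ => {y : ℝ | x < |y| ∧ |y| ≤ 2 ^ k * x} := by
      intro k l hkl y hy
      refine ⟨hy.1, hy.2.trans ?_⟩
      gcongr
      exact one_le_two
    rw [hU, setLIntegral_iUnion_of_directed _ hmono.directed_le]
    exact iSup_le fun k => key k x hx
  have hI : IntegrableOn (fun y : ℝ => |y|) {y | x < |y|} ν := by
    refine ⟨by fun_prop, ?_⟩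
    rw [hasFiniteIntegral_iff_ofReal (Eventually.of_forall fun y => abs_nonneg y)]
    exact hle.trans_lt ENNReal.ofReal_lt_top
  refine ⟨hI, ?_⟩
  rw [integral_eq_lintegral_of_nonneg_ae (Eventually.of_forall fun y => abs_nonneg y)
    (by fun_prop)]
  exact ENNReal.toReal_le_of_le_ofReal
    (mul_nonneg (by positivity) (absTail_nonneg _)) hle

end Tail

/-! ### Truncated moments and the tail -/

lemma truncOne_mul_eq_indicator {t : ℝ} (ht : t ≠ 0) :
    (fun y => truncOne (t * y)) = {y : ℝ | |y| ≤ |t|⁻¹}.indicator (fun y => t * y) := by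
  ext y
  simp only [truncOne, indicator, mem_ofPred_eq]
  have := one_lt_abs_mul_iff ht y
  rw [← not_le, ← not_le, not_iff_not] at this
  simp only [this]

lemma integral_abs_truncOne_mul_pow {ν : Measure ℝ} {β : ℕ} (hβ : β ≠ 0) {t : ℝ} (ht : t ≠ 0) :
    ∫ y, |truncOne (t * y)| ^ β ∂ν = |t| ^ β * ∫ y in {y | |y| ≤ |t|⁻¹}, |y| ^ β ∂ν := by
  rw [← integral_const_mul, ← integral_indicator (measurableSet_abs_le _)]
  congr 1
  ext y
  rw [congrFun (truncOne_mul_eq_indicator ht) y]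
  by_cases hy : y ∈ {y : ℝ | |y| ≤ |t|⁻¹}
  · rw [indicator_of_mem hy, indicator_of_mem hy, abs_mul, mul_pow]
  · rw [indicator_of_notMem hy, indicator_of_notMem hy, abs_zero, zero_pow hβ]

lemma integrable_truncOne_comp {Ω : Type*} [MeasurableSpace Ω] {μ : Measure Ω}
    [IsFiniteMeasure μ] {X : Ω → ℝ} (hX : Measurable X) :
    Integrable (fun ω => truncOne (X ω)) μ :=
  Integrable.of_bound (measurable_truncOne.comp hX).aestronglyMeasurable 1
    (Eventually.of_forall fun _ => abs_truncOne_le _)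

lemma integral_abs_truncOne_pow_le_one {ν : Measure ℝ} [IsProbabilityMeasure ν] (β : ℕ) (t : ℝ) :
    ∫ y, |truncOne (t * y)| ^ β ∂ν ≤ 1 := by
  have h : ‖∫ y, |truncOne (t * y)| ^ β ∂ν‖ ≤ 1 * ν.real univ := by
    refine norm_integral_le_of_norm_le_const (Eventually.of_forall fun y => ?_)
    rw [norm_pow, Real.norm_eq_abs, abs_abs]
    exact pow_le_one₀ (abs_nonneg _) (abs_truncOne_le _)
  simpa using (le_abs_self _).trans h

lemma abs_integral_truncOne_le_integral_abs {ν : Measure ℝ} (t : ℝ) :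
    |∫ y, truncOne (t * y) ∂ν| ≤ ∫ y, |truncOne (t * y)| ^ 1 ∂ν := by
  simpa using abs_integral_le_integral_abs (f := fun y => truncOne (t * y)) (μ := ν)

section Truncation

variable {ν : Measure ℝ} [IsProbabilityMeasure ν] {α : ℝ}

/-- Truncated moments of order `β > α` are dominated by the tail, at every scale. -/
lemma HasTailIndex.integral_abs_truncOne_pow_le (hν : HasTailIndex ν α) {β : ℕ} (hβ0 : β ≠ 0)
    (hβ : α < β) :
    ∃ K, ∀ t, ∫ y, |truncOne (t * y)| ^ β ∂ν ≤ K * scaledTail ν t := by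
  obtain ⟨C, X, hX, h⟩ := hν.setIntegral_abs_pow_le hβ
  refine hν.le_scaledTail_of_small (C := C) ?_ (integral_abs_truncOne_pow_le_one β) hX
    fun t ht hXt => ?_
  · simp [truncOne, hβ0]
  · rw [integral_abs_truncOne_mul_pow hβ0 ht]
    have ht' : |t| ≠ 0 := abs_ne_zero.2 ht
    calc |t| ^ β * ∫ y in {y | |y| ≤ |t|⁻¹}, |y| ^ β ∂ν
        ≤ |t| ^ β * (C * |t|⁻¹ ^ β * absTail ν |t|⁻¹) := by gcongr; exact h _ hXt
      _ = (|t| ^ β * |t|⁻¹ ^ β) * (C * absTail ν |t|⁻¹) := by ring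
      _ = C * absTail ν |t|⁻¹ := by rw [← mul_pow, mul_inv_cancel₀ ht', one_pow, one_mul]

/-- For a centred law with `α > 1` the truncated mean is minus the mean of the removed part, hence
dominated by the tail. -/
lemma HasTailIndex.abs_integral_truncOne_le_of_centred (hν : HasTailIndex ν α) (hα : 1 < α)
    (hmean : ∫ y, y ∂ν = 0) :
    ∃ K, ∀ t, |∫ y, truncOne (t * y) ∂ν| ≤ K * scaledTail ν t := by
  obtain ⟨C, X, hX, h⟩ := hν.setIntegral_abs_tail_le hα
  refine hν.le_scaledTail_of_small (C := C) ?_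
    (fun t => (abs_integral_truncOne_le_integral_abs t).trans
      (integral_abs_truncOne_pow_le_one 1 t)) hX
    fun t ht hXt => ?_
  · simp [truncOne]
  obtain ⟨hI, hle⟩ := h _ hXt
  have hcompl : {y : ℝ | |y| ≤ |t|⁻¹}ᶜ = {y | |t|⁻¹ < |y|} := by
    ext y
    simp
  have hm := measurableSet_abs_le |t|⁻¹
  have hid : Integrable (fun y : ℝ => y) ν := by
    simp_rw [← integrable_norm_iff (f := fun y : ℝ => y) (μ := ν) (by fun_prop), Real.norm_eq_abs]
    rw [← integrableOn_univ,
      ← union_compl_self {y : ℝ | |y| ≤ |t|⁻¹}, hcompl]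
    exact IntegrableOn.union (by simpa using integrableOn_abs_pow (ν := ν) 1 |t|⁻¹) hI
  have hsplit := integral_add_compl hm (hid.const_mul t)
  rw [hcompl, integral_const_mul t (fun y : ℝ => y) (μ := ν), hmean, mul_zero,
    ← integral_indicator hm, ← truncOne_mul_eq_indicator ht] at hsplit
  rw [eq_neg_of_add_eq_zero_left hsplit, abs_neg, integral_const_mul, abs_mul]
  have ht' : |t| ≠ 0 := abs_ne_zero.2 ht
  calc |t| * |∫ y in {y | |t|⁻¹ < |y|}, y ∂ν|
      ≤ |t| * (C * |t|⁻¹ * absTail ν |t|⁻¹) := by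
        gcongr
        exact abs_integral_le_integral_abs.trans hle
    _ = C * absTail ν |t|⁻¹ := by field_simp

/-- Under the standing assumptions on the law, the truncated mean is dominated by the tail. -/
lemma HasTailIndex.abs_integral_truncOne_le (hν : HasTailIndex ν α)
    (hmean : 1 < α → ∫ y, y ∂ν = 0) (hsymm : α = 1 → ν.map (fun y => -y) = ν) :
    ∃ K, ∀ t, |∫ y, truncOne (t * y) ∂ν| ≤ K * scaledTail ν t := by
  -- for `α < 1` the first truncated moment itself is small; for `α = 1` the mean vanishes
  rcases lt_trichotomy α 1 with h | h | h
  · obtain ⟨K, hle⟩ := hν.integral_abs_truncOne_pow_le one_ne_zero (by simpa using h)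
    exact ⟨K, fun t => (abs_integral_truncOne_le_integral_abs t).trans (hle t)⟩
  · refine ⟨0, fun t => ?_⟩
    have h1 : ∫ y, truncOne (t * y) ∂ν = -∫ y, truncOne (t * y) ∂ν := by
      conv_lhs => rw [← hsymm h]
      have hm : Measurable fun y => truncOne (t * y) :=
        measurable_truncOne.comp (measurable_const_mul t)
      rw [integral_map (by fun_prop) hm.aestronglyMeasurable]
      simp_rw [mul_neg, truncOne_neg]
      exact integral_neg _
    have h2 : ∫ y, truncOne (t * y) ∂ν = 0 := by linarith
    simp [h2]
  · exact hν.abs_integral_truncOne_le_of_centred h (hmean h)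

end Truncation

/-! ### Characteristic functions and tails -/

section CharFun

variable {ν : Measure ℝ} [IsProbabilityMeasure ν] {α : ℝ}

/-- Symmetrization: `|φ|²` is the characteristic function of the difference of two independent
variables with characteristic function `φ`. -/
lemma one_sub_norm_charFun_sq_eq (t : ℝ) :
    1 - ‖charFun ν t‖ ^ 2 = ∫ z : ℝ × ℝ, (1 - Real.cos (t * (z.1 - z.2))) ∂(ν.prod ν) := by
  have h1 : ((‖charFun ν t‖ ^ 2 : ℝ) : ℂ) =
      ∫ z : ℝ × ℝ, Complex.exp (t * (z.1 - z.2) * Complex.I) ∂(ν.prod ν) := by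
    have : ∀ z : ℝ × ℝ, Complex.exp (t * (z.1 - z.2) * Complex.I) =
        Complex.exp (t * z.1 * Complex.I) * Complex.exp ((-t : ℝ) * z.2 * Complex.I) := by
      intro z
      rw [← Complex.exp_add]
      congr 1
      push_cast
      ring
    simp_rw [this]
    rw [integral_prod_mul (fun x : ℝ => Complex.exp (t * x * Complex.I))
      (fun y : ℝ => Complex.exp ((-t : ℝ) * y * Complex.I)), ← charFun_apply_real,
      ← charFun_apply_real, charFun_neg, Complex.mul_conj, Complex.normSq_eq_norm_sq]
  have hint : Integrable (fun z : ℝ × ℝ => Complex.exp (t * (z.1 - z.2) * Complex.I))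
      (ν.prod ν) := by
    refine Integrable.of_bound (by fun_prop) 1 (Eventually.of_forall fun z => ?_)
    have := Complex.norm_exp_ofReal_mul_I (t * (z.1 - z.2))
    push_cast at this
    exact this.le
  have hre : ∀ z : ℝ × ℝ, (Complex.exp (t * (z.1 - z.2) * Complex.I)).re =
      Real.cos (t * (z.1 - z.2)) := by
    intro z
    have := Complex.exp_ofReal_mul_I_re (t * (z.1 - z.2))
    push_cast at this
    exact this
  have h2 : ‖charFun ν t‖ ^ 2 = ∫ z : ℝ × ℝ, Real.cos (t * (z.1 - z.2)) ∂(ν.prod ν) := by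
    have h3 := congrArg Complex.re h1
    rw [Complex.ofReal_re] at h3
    rw [h3]
    simp_rw [← hre]
    exact (integral_re hint).symm
  have hint' : Integrable (fun z : ℝ × ℝ => Real.cos (t * (z.1 - z.2))) (ν.prod ν) := by
    simp_rw [← hre]
    exact hint.re
  rw [integral_sub (integrable_const _) hint', ← h2]
  simp

lemma exists_half_le_measure_abs_le (ν : Measure ℝ) [IsProbabilityMeasure ν] :
    ∃ M : ℝ, 0 < M ∧ 1 / 2 ≤ ν.real {y | |y| ≤ M} := by
  have hmono : Monotone fun n : ℕ => {y : ℝ | |y| ≤ n} := fun m n hmn y hy =>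
    le_trans (α := ℝ) hy (by exact_mod_cast hmn)
  have hU : ⋃ n : ℕ, {y : ℝ | |y| ≤ n} = univ := by
    ext y
    simpa using exists_nat_ge |y|
  have h := tendsto_measure_iUnion_atTop (μ := ν) hmono
  rw [hU, measure_univ] at h
  have h' : Tendsto (fun n : ℕ => ν.real {y : ℝ | |y| ≤ n}) atTop (𝓝 1) :=
    (ENNReal.tendsto_toReal ENNReal.one_ne_top).comp h
  obtain ⟨n, hn, hn0⟩ := ((h'.eventually_const_lt (by norm_num : (1 / 2 : ℝ) < 1)).and
    (eventually_gt_atTop 0)).exists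
  exact ⟨n, by exact_mod_cast hn0, hn.le⟩

/-- For small `t`, the defect of `|φ t|` from `1` controls the tail: the symmetrized variable has
`t * (x - y)` between `1/2` and `5/2` in modulus whenever `1 < |t x| ≤ 2` and `|y|` is bounded. -/
lemma HasTailIndex.scaledTail_le_one_sub_norm_charFun_sq (hν : HasTailIndex ν α) (hα : 0 < α) :
    ∃ κ t₀ : ℝ, 0 < κ ∧ 0 < t₀ ∧ ∀ t, |t| ≤ t₀ →
      κ * scaledTail ν t ≤ 1 - ‖charFun ν t‖ ^ 2 := by
  have hlt : (2 : ℝ) ^ (-α) < 1 := Real.rpow_lt_one_of_one_lt_of_neg one_lt_two (by linarith)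
  obtain ⟨q, hq1, hq2⟩ := exists_between hlt
  obtain ⟨X, hX⟩ := eventually_atTop.1 ((hν.ratio.eventually_lt_const hq1).and
    (eventually_gt_atTop 0))
  have hX0 : 0 < X := (hX X le_rfl).2
  obtain ⟨M, hM0, hM⟩ := exists_half_le_measure_abs_le ν
  set κ₀ := 1 - Real.cos (1 / 2) with hκ₀
  have hκ₀0 : 0 < κ₀ := by
    have := Real.cos_lt_cos_of_nonneg_of_le_pi_div_two le_rfl
      (by linarith [Real.pi_gt_three]) (by norm_num : (0 : ℝ) < 1 / 2)
    rw [Real.cos_zero] at this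
    linarith
  refine ⟨κ₀ * (1 / 2) * (1 - q), min X⁻¹ (2 * M)⁻¹, ?_, by positivity, fun t ht => ?_⟩
  · have : 0 < 1 - q := by linarith
    positivity
  rcases eq_or_ne t 0 with rfl | ht0
  · simp [scaledTail_zero]
  have ht' : 0 < |t| := abs_pos.2 ht0
  have htX : X ≤ |t|⁻¹ := by
    rw [le_inv_comm₀ hX0 ht']
    exact ht.trans (min_le_left _ _)
  have htM : |t| * M ≤ 1 / 2 := by
    calc |t| * M ≤ (2 * M)⁻¹ * M := by gcongr; exact ht.trans (min_le_right _ _)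
      _ = 1 / 2 := by field_simp
  set A : Set ℝ := {x | |t|⁻¹ < |x|} \ {x | 2 * |t|⁻¹ < |x|} with hA
  set B : Set ℝ := {y | |y| ≤ M} with hB
  have hmA : MeasurableSet A := (measurableSet_lt_abs _).diff (measurableSet_lt_abs _)
  have hmB : MeasurableSet B := measurableSet_abs_le _
  have hνA : (1 - q) * scaledTail ν t ≤ ν.real A := by
    have hsub : {x : ℝ | 2 * |t|⁻¹ < |x|} ⊆ {x | |t|⁻¹ < |x|} := fun x hx =>
      lt_of_le_of_lt (le_mul_of_one_le_left (inv_pos.2 ht').le one_le_two) hx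
    rw [hA, measureReal_sdiff hsub (measurableSet_lt_abs _), scaledTail_eq_absTail ν ht0]
    have := ((div_lt_iff₀ (hν.pos _ (inv_pos.2 ht'))).1 (hX _ htX).1).le
    simp only [absTail] at this ⊢
    linarith
  have hcos : ∀ z ∈ A ×ˢ B, κ₀ ≤ 1 - Real.cos (t * (z.1 - z.2)) := by
    rintro ⟨x, y⟩ ⟨hx, hy⟩
    simp only [hA, Set.mem_sdiff, mem_ofPred_eq, not_lt, hB] at hx hy ⊢
    have h1 : 1 < |t * x| := (one_lt_abs_mul_iff ht0 x).2 hx.1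
    have h2 : |t * x| ≤ 2 := by
      rw [abs_mul]
      calc |t| * |x| ≤ |t| * (2 * |t|⁻¹) := by gcongr; exact hx.2
        _ = 2 := by field_simp
    have h3 : |t * y| ≤ 1 / 2 := by
      rw [abs_mul]
      exact (by gcongr : |t| * |y| ≤ |t| * M).trans htM
    have h4 : 1 / 2 ≤ |t * (x - y)| := by
      rw [mul_sub]
      linarith [abs_sub_abs_le_abs_sub (t * x) (t * y)]
    have h5 : |t * (x - y)| ≤ 5 / 2 := by
      rw [mul_sub]
      linarith [abs_sub (t * x) (t * y)]
    rw [← Real.cos_abs (t * (x - y))]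
    have := Real.cos_le_cos_of_nonneg_of_le_pi (by norm_num : (0 : ℝ) ≤ 1 / 2)
      (by linarith [Real.pi_gt_three]) h4
    linarith
  have hnn : ∀ z : ℝ × ℝ, 0 ≤ 1 - Real.cos (t * (z.1 - z.2)) := fun z => by
    linarith [Real.cos_le_one (t * (z.1 - z.2))]
  have hint : Integrable (fun z : ℝ × ℝ => 1 - Real.cos (t * (z.1 - z.2))) (ν.prod ν) := by
    refine Integrable.of_bound (by fun_prop) 2 (Eventually.of_forall fun z => ?_)
    rw [Real.norm_of_nonneg (hnn z)]
    linarith [Real.neg_one_le_cos (t * (z.1 - z.2))]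
  rw [one_sub_norm_charFun_sq_eq]
  calc κ₀ * (1 / 2) * (1 - q) * scaledTail ν t = κ₀ * (((1 - q) * scaledTail ν t) * (1 / 2)) := by
        ring
    _ ≤ κ₀ * (ν.real A * ν.real B) := by gcongr
    _ = κ₀ * (ν.prod ν).real (A ×ˢ B) := by rw [measureReal_prod_prod]
    _ ≤ ∫ z in A ×ˢ B, (1 - Real.cos (t * (z.1 - z.2))) ∂(ν.prod ν) :=
        setIntegral_ge_of_const_le_real (hmA.prod hmB) (by finiteness) hcos hint.integrableOn
    _ ≤ ∫ z, (1 - Real.cos (t * (z.1 - z.2))) ∂(ν.prod ν) :=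
        setIntegral_le_integral hint (Eventually.of_forall hnn)

end CharFun

/-! ### Series of independent random variables -/

section Series

variable {Ω : Type*} [MeasurableSpace Ω] {μ : Measure Ω} [IsProbabilityMeasure μ]

lemma memLp_two_of_bound {Z : Ω → ℝ} (hZ : Measurable Z) {B : ℝ} (hB : ∀ ω, |Z ω| ≤ B) :
    MemLp Z 2 μ :=
  MemLp.of_bound hZ.aestronglyMeasurable B (Eventually.of_forall hB)

/-- The second moment of a finite sum of bounded independent variables. -/
lemma integral_sum_sq_le {ι : Type*} {Z : ι → Ω → ℝ} (hZ : ∀ i, Measurable (Z i)) {B : ℝ}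
    (hB : ∀ i ω, |Z i ω| ≤ B) (hind : iIndepFun Z μ) (s : Finset ι) :
    ∫ ω, (∑ i ∈ s, Z i ω) ^ 2 ∂μ ≤
      ∑ i ∈ s, ∫ ω, Z i ω ^ 2 ∂μ + (∑ i ∈ s, ∫ ω, Z i ω ∂μ) ^ 2 := by
  have hL : ∀ i, MemLp (Z i) 2 μ := fun i => memLp_two_of_bound (hZ i) (hB i)
  have h1 := IndepFun.variance_sum (s := s) (fun i _ => hL i)
    (fun i _ j _ hij => hind.indepFun hij)
  rw [variance_eq_sub (memLp_finsetSum' s fun i _ => hL i)] at h1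
  have h2 : ∑ i ∈ s, Var[Z i; μ] ≤ ∑ i ∈ s, ∫ ω, Z i ω ^ 2 ∂μ :=
    Finset.sum_le_sum fun i _ => variance_le_expectation_sq (hZ i).aestronglyMeasurable
  have h3 : ∫ ω, (∑ i ∈ s, Z i) ω ∂μ = ∑ i ∈ s, ∫ ω, Z i ω ∂μ := by
    simp_rw [Finset.sum_apply]
    exact integral_finsetSum s fun i _ => (hL i).integrable one_le_two
  rw [h3] at h1
  have h4 : ∫ ω, ((∑ i ∈ s, Z i) ^ 2) ω ∂μ = ∫ ω, (∑ i ∈ s, Z i ω) ^ 2 ∂μ := by simp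
  rw [h4] at h1
  linarith

/-- Kolmogorov's convergence criterion: a series of bounded independent centred variables with
summable second moments converges almost surely, its partial sums being an `L¹`-bounded
martingale. -/
lemma ae_exists_tendsto_sum_of_centred {Z : ℕ → Ω → ℝ} (hZ : ∀ k, Measurable (Z k)) {B : ℝ}
    (hB : ∀ k ω, |Z k ω| ≤ B) (hind : iIndepFun Z μ) (hmean : ∀ k, ∫ ω, Z k ω ∂μ = 0)
    (hsum : Summable fun k => ∫ ω, Z k ω ^ 2 ∂μ) :
    ∀ᵐ ω ∂μ, ∃ l, Tendsto (fun n => ∑ k ∈ Finset.range n, Z k ω) atTop (𝓝 l) := by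
  have hsm : ∀ k, StronglyMeasurable (Z k) := fun k => (hZ k).stronglyMeasurable
  have hint : ∀ k, Integrable (Z k) μ := fun k =>
    (memLp_two_of_bound (hZ k) (hB k)).integrable one_le_two
  set S : ℕ → Ω → ℝ := fun n => ∑ k ∈ Finset.range (n + 1), Z k with hS
  have hSint : ∀ n, Integrable (S n) μ := fun n => integrable_finsetSum' _ fun k _ => hint k
  have hadp : StronglyAdapted (Filtration.natural Z hsm) S := fun n =>
    Finset.stronglyMeasurable_sum _ fun k hk =>
      ((Filtration.stronglyAdapted_natural hsm) k).mono
        ((Filtration.natural Z hsm).mono (Nat.lt_succ_iff.1 (Finset.mem_range.1 hk)))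
  have hmart : Martingale S (Filtration.natural Z hsm) μ := by
    refine martingale_of_condExp_sub_eq_zero_nat hadp hSint fun n => ?_
    have : S (n + 1) - S n = Z (n + 1) := by
      simp only [hS]
      rw [Finset.sum_range_succ _ (n + 1)]
      simp
    rw [this]
    refine (iIndepFun.condExp_natural_ae_eq_of_lt hsm hind n.lt_succ_self).trans ?_
    rw [hmean]
    rfl
  have hbdd : ∀ n, eLpNorm (S n) 1 μ ≤
      ((1 + ∑' k, ∫ ω, Z k ω ^ 2 ∂μ).toNNReal : ENNReal) := by
    intro n
    have hSL : MemLp (S n) 2 μ :=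
      memLp_finsetSum' _ fun k _ => memLp_two_of_bound (hZ k) (hB k)
    rw [eLpNorm_one_eq_lintegral_enorm, ← ofReal_integral_norm_eq_lintegral_enorm (hSint n)]
    refine ENNReal.ofReal_le_ofReal ?_
    calc ∫ ω, ‖S n ω‖ ∂μ ≤ ∫ ω, (1 + S n ω ^ 2) ∂μ := by
          refine integral_mono (hSint n).norm ((integrable_const _).add hSL.integrable_sq)
            fun ω => ?_
          rw [Real.norm_eq_abs]
          nlinarith [sq_abs (S n ω), sq_nonneg (|S n ω| - 1)]
      _ = 1 + ∫ ω, (∑ k ∈ Finset.range (n + 1), Z k ω) ^ 2 ∂μ := by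
          rw [integral_add (integrable_const _) hSL.integrable_sq]
          simp [hS]
      _ ≤ 1 + ∑' k, ∫ ω, Z k ω ^ 2 ∂μ := by
          have h := integral_sum_sq_le hZ hB hind (Finset.range (n + 1))
          simp only [hmean, Finset.sum_const_zero, ne_eq, OfNat.ofNat_ne_zero, not_false_eq_true,
            zero_pow, add_zero] at h
          have h' := hsum.sum_le_tsum (Finset.range (n + 1))
            fun k _ => integral_nonneg fun ω => sq_nonneg (Z k ω)
          linarith
  filter_upwards [hmart.submartingale.exists_ae_tendsto_of_bdd hbdd] with ω ⟨l, hl⟩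
  refine ⟨l, (tendsto_add_atTop_iff_nat 1).1 ?_⟩
  simpa [hS] using hl

/-- The sufficient half of Kolmogorov's three-series theorem, for series indexed by `ℕ`. -/
lemma ae_exists_tendsto_sum_of_three_series {X : ℕ → Ω → ℝ} (hX : ∀ k, Measurable (X k))
    (hind : iIndepFun X μ) (h₁ : Summable fun k => μ.real {ω | 1 < |X k ω|})
    (h₂ : Summable fun k => |∫ ω, truncOne (X k ω) ∂μ|)
    (h₃ : Summable fun k => ∫ ω, truncOne (X k ω) ^ 2 ∂μ) :
    ∀ᵐ ω ∂μ, ∃ l, Tendsto (fun n => ∑ k ∈ Finset.range n, X k ω) atTop (𝓝 l) := by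
  set m : ℕ → ℝ := fun k => ∫ ω, truncOne (X k ω) ∂μ with hm
  set Z : ℕ → Ω → ℝ := fun k ω => truncOne (X k ω) - m k with hZdef
  have hmU : ∀ k, Measurable fun ω => truncOne (X k ω) := fun k => measurable_truncOne.comp (hX k)
  have hm1 : ∀ k, |m k| ≤ 1 := fun k => by
    have : ‖∫ ω, truncOne (X k ω) ∂μ‖ ≤ 1 * μ.real univ :=
      norm_integral_le_of_norm_le_const (Eventually.of_forall fun ω => abs_truncOne_le _)
    simpa using this
  have hZ : ∀ k, Measurable (Z k) := fun k => (hmU k).sub_const _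
  have hB : ∀ k ω, |Z k ω| ≤ 2 := fun k ω => by
    have := abs_sub (truncOne (X k ω)) (m k)
    have := abs_truncOne_le (X k ω)
    have := hm1 k
    simp only [hZdef]
    linarith
  have hindZ : iIndepFun Z μ :=
    hind.comp (fun k x => truncOne x - m k) fun k => measurable_truncOne.sub_const _
  have hmean : ∀ k, ∫ ω, Z k ω ∂μ = 0 := fun k => by
    simp only [hZdef]
    rw [integral_sub (integrable_truncOne_comp (hX k)) (integrable_const _)]
    simp [hm]
  have hsum : Summable fun k => ∫ ω, Z k ω ^ 2 ∂μ := by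
    refine h₃.of_nonneg_of_le (fun k => integral_nonneg fun ω => sq_nonneg _) fun k => ?_
    have := variance_le_expectation_sq (μ := μ) (hmU k).aestronglyMeasurable
    rw [variance_eq_integral (hmU k).aemeasurable] at this
    exact this
  have hBC : ∀ᵐ ω ∂μ, ∀ᶠ k in atTop, ω ∉ {ω | 1 < |X k ω|} := by
    refine ae_eventually_notMem ?_
    have : ∀ k, μ {ω | 1 < |X k ω|} = ENNReal.ofReal (μ.real {ω | 1 < |X k ω|}) := fun k =>
      (ofReal_measureReal).symm
    simp_rw [this]
    rw [← ENNReal.ofReal_tsum_of_nonneg (fun k => measureReal_nonneg) h₁]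
    exact ENNReal.ofReal_ne_top
  filter_upwards [ae_exists_tendsto_sum_of_centred hZ hB hindZ hmean hsum, hBC]
    with ω ⟨l, hl⟩ hω
  have hdiff : Summable fun k => X k ω - truncOne (X k ω) := by
    refine summable_of_hasFiniteSupport (hω.exists_forall_of_atTop.elim fun N hN =>
      (finite_Iio N).subset fun k hk => ?_)
    by_contra hk'
    refine hk ?_
    have := hN k (not_lt.1 hk')
    simp only [not_lt] at this
    simp [truncOne, this]
  refine ⟨_, ((hl.add h₂.of_abs.hasSum.tendsto_sum_nat).add
    hdiff.hasSum.tendsto_sum_nat).congr fun n => ?_⟩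
  rw [← Finset.sum_add_distrib, ← Finset.sum_add_distrib]
  refine Finset.sum_congr rfl fun k _ => ?_
  simp only [hZdef]
  ring

lemma sum_Icc_neg_eq (f : ℤ → ℝ) (m n : ℕ) :
    ∑ j ∈ Finset.Icc (-(m : ℤ)) n, f j =
      ∑ k ∈ Finset.range (n + 1), f k + ∑ k ∈ Finset.range m, f (-(k + 1 : ℤ)) := by
  induction m with
  | zero =>
    induction n with
    | zero => simp
    | succ n ih =>
      have : Finset.Icc (-((0 : ℕ) : ℤ)) ((n + 1 : ℕ) : ℤ) =
          insert ((n + 1 : ℕ) : ℤ) (Finset.Icc (-((0 : ℕ) : ℤ)) (n : ℤ)) := by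
        ext j
        simp only [Finset.mem_insert, Finset.mem_Icc]
        omega
      rw [this, Finset.sum_insert (by simp), ih, Finset.sum_range_succ _ (n + 1)]
      ring
  | succ m ih =>
    have : Finset.Icc (-((m + 1 : ℕ) : ℤ)) (n : ℤ) =
        insert (-((m : ℤ) + 1)) (Finset.Icc (-(m : ℤ)) n) := by
      ext j
      simp only [Finset.mem_insert, Finset.mem_Icc]
      omega
    rw [this, Finset.sum_insert (by simp), ih, Finset.sum_range_succ _ m]
    ring

/-- A two-sided series whose two halves converge is conditionally summable. -/
lemma summable_conditional_of_tendsto {f : ℤ → ℝ} {a b : ℝ}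
    (ha : Tendsto (fun n => ∑ k ∈ Finset.range n, f (k : ℤ)) atTop (𝓝 a))
    (hb : Tendsto (fun n => ∑ k ∈ Finset.range n, f (-(k + 1 : ℤ))) atTop (𝓝 b)) :
    Summable f (SummationFilter.conditional ℤ) := by
  refine ⟨a + b, ?_⟩
  rw [HasSum, SummationFilter.conditional_filter, tendsto_map'_iff]
  have h1 : Tendsto (fun p : ℤ × ℤ => p.2.toNat + 1) (atBot ×ˢ atTop) atTop :=
    (tendsto_atTop_atTop.2 fun n => ⟨n, fun j hj => by omega⟩ :
      Tendsto (fun j : ℤ => j.toNat + 1) atTop atTop).comp tendsto_snd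
  have h2 : Tendsto (fun p : ℤ × ℤ => (-p.1).toNat) (atBot ×ˢ atTop) atTop :=
    (tendsto_atBot_atTop.2 fun n => ⟨-(n : ℤ), fun j hj => by omega⟩ :
      Tendsto (fun j : ℤ => (-j).toNat) atBot atTop).comp tendsto_fst
  refine ((ha.comp h1).add (hb.comp h2)).congr' ?_
  filter_upwards [prod_mem_prod (eventually_le_atBot 0) (eventually_ge_atTop 0)] with p hp
  obtain ⟨hp1, hp2⟩ : p.1 ≤ 0 ∧ 0 ≤ p.2 := hp
  have h := sum_Icc_neg_eq f (-p.1).toNat p.2.toNat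
  rw [Int.toNat_of_nonneg (by omega), Int.toNat_of_nonneg hp2, neg_neg] at h
  exact h.symm

/-- The sufficient half of Kolmogorov's three-series theorem, for two-sided series. -/
lemma ae_summable_conditional_of_three_series {X : ℤ → Ω → ℝ} (hX : ∀ j, Measurable (X j))
    (hind : iIndepFun X μ) (h₁ : Summable fun j => μ.real {ω | 1 < |X j ω|})
    (h₂ : Summable fun j => |∫ ω, truncOne (X j ω) ∂μ|)
    (h₃ : Summable fun j => ∫ ω, truncOne (X j ω) ^ 2 ∂μ) :
    ∀ᵐ ω ∂μ, Summable (fun j => X j ω) (SummationFilter.conditional ℤ) := by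
  have key : ∀ g : ℕ → ℤ, g.Injective →
      ∀ᵐ ω ∂μ, ∃ l, Tendsto (fun n => ∑ k ∈ Finset.range n, X (g k) ω) atTop (𝓝 l) :=
    fun g hg => ae_exists_tendsto_sum_of_three_series (fun k => hX (g k)) (hind.precomp hg)
      (h₁.comp_injective hg) (h₂.comp_injective hg) (h₃.comp_injective hg)
  filter_upwards [key (fun k => (k : ℤ)) Nat.cast_injective,
    key (fun k => -(k + 1 : ℤ)) (fun k l h => by simpa using h)] with ω ⟨a, ha⟩ ⟨b, hb⟩
  exact summable_conditional_of_tendsto ha hb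

lemma HasSum.tendsto_sum_Icc_neg {f : ℤ → ℝ} {a : ℝ}
    (h : HasSum f a (SummationFilter.conditional ℤ)) :
    Tendsto (fun N : ℕ => ∑ j ∈ Finset.Icc (-(N : ℤ)) N, f j) atTop (𝓝 a) := by
  rw [HasSum, SummationFilter.conditional_filter, tendsto_map'_iff] at h
  have h1 : Tendsto (fun N : ℕ => (N : ℤ)) atTop atTop := tendsto_natCast_atTop_atTop
  have h2 : Tendsto (fun N : ℕ => -(N : ℤ)) atTop atBot := tendsto_neg_atTop_atBot.comp h1
  have h3 : Tendsto (fun N : ℕ => (-(N : ℤ), (N : ℤ))) atTop (atBot ×ˢ atTop) := h2.prodMk h1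
  simpa only [Function.comp_def] using h.comp h3

/-- A tail bound for an almost surely convergent two-sided series of independent variables: either
some term exceeds `1`, or the sum is a limit of truncated sums, to which Chebyshev applies. -/
lemma measure_le_abs_series_le {X : ℤ → Ω → ℝ} (hX : ∀ j, Measurable (X j))
    (hind : iIndepFun X μ) (h₁ : Summable fun j => μ.real {ω | 1 < |X j ω|})
    (h₂ : Summable fun j => |∫ ω, truncOne (X j ω) ∂μ|)
    (h₃ : Summable fun j => ∫ ω, truncOne (X j ω) ^ 2 ∂μ) {V : Ω → ℝ}
    (hV : ∀ᵐ ω ∂μ, HasSum (fun j => X j ω) (V ω) (SummationFilter.conditional ℤ))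
    {ε : ℝ} (hε : 0 < ε) :
    μ {ω | ε ≤ |V ω|} ≤ ENNReal.ofReal (∑' j, μ.real {ω | 1 < |X j ω|} +
      (∑' j, ∫ ω, truncOne (X j ω) ^ 2 ∂μ + (∑' j, |∫ ω, truncOne (X j ω) ∂μ|) ^ 2) / ε ^ 2) := by
  set U : ℤ → Ω → ℝ := fun j ω => truncOne (X j ω) with hU
  have hmU : ∀ j, Measurable (U j) := fun j => measurable_truncOne.comp (hX j)
  have hindU : iIndepFun U μ := hind.comp (fun _ => truncOne) fun _ => measurable_truncOne
  set K := ∑' j, ∫ ω, U j ω ^ 2 ∂μ + (∑' j, |∫ ω, U j ω ∂μ|) ^ 2 with hK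
  have hK0 : 0 ≤ K := add_nonneg (tsum_nonneg fun j => integral_nonneg fun ω => sq_nonneg _)
    (sq_nonneg _)
  set F : ℕ → Ω → ENNReal := fun N ω =>
    ENNReal.ofReal ((∑ j ∈ Finset.Icc (-(N : ℤ)) N, U j ω) ^ 2) with hF
  have hFm : ∀ N, Measurable (F N) := fun N => by
    have : Measurable fun ω => ∑ j ∈ Finset.Icc (-(N : ℤ)) N, U j ω :=
      Finset.measurable_sum _ fun j _ => hmU j
    exact (this.pow_const 2).ennreal_ofReal
  have hFint : ∀ N, ∫⁻ ω, F N ω ∂μ ≤ ENNReal.ofReal K := by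
    intro N
    have hL : MemLp (fun ω => ∑ j ∈ Finset.Icc (-(N : ℤ)) N, U j ω) 2 μ :=
      memLp_finsetSum _ fun j _ => memLp_two_of_bound (hmU j) fun ω => abs_truncOne_le _
    rw [hF, ← ofReal_integral_eq_lintegral_ofReal hL.integrable_sq
      (Eventually.of_forall fun ω => sq_nonneg _)]
    refine ENNReal.ofReal_le_ofReal ((integral_sum_sq_le hmU (fun j ω => abs_truncOne_le _)
      hindU _).trans ?_)
    refine add_le_add (h₃.sum_le_tsum _ fun j _ => integral_nonneg fun ω => sq_nonneg _) ?_
    rw [← sq_abs]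
    refine pow_le_pow_left₀ (abs_nonneg _) ((Finset.abs_sum_le_sum_abs _ _).trans
      (h₂.sum_le_tsum _ fun j _ => abs_nonneg _)) 2
  have hsub : ∀ᵐ ω ∂μ, ω ∈ {ω | ε ≤ |V ω|} → ω ∈ (⋃ j, {ω | 1 < |X j ω|}) ∪
      {ω | ENNReal.ofReal (ε ^ 2) ≤ liminf (fun N => F N ω) atTop} := by
    filter_upwards [hV] with ω hω hωε
    by_cases hex : ω ∈ ⋃ j, {ω | 1 < |X j ω|}
    · exact Or.inl hex
    refine Or.inr ?_
    have hXU : ∀ j, U j ω = X j ω := fun j => by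
      have : |X j ω| ≤ 1 := by
        by_contra h
        exact hex (mem_iUnion.2 ⟨j, not_le.1 h⟩)
      simp [hU, truncOne, this]
    have hlim : Tendsto (fun N => F N ω) atTop (𝓝 (ENNReal.ofReal (V ω ^ 2))) := by
      simp only [hF, hXU]
      exact ENNReal.tendsto_ofReal (hω.tendsto_sum_Icc_neg.pow 2)
    rw [mem_ofPred_eq, hlim.liminf_eq, ← sq_abs (V ω)]
    exact ENNReal.ofReal_le_ofReal (pow_le_pow_left₀ hε.le hωε 2)
  calc μ {ω | ε ≤ |V ω|} ≤ μ (⋃ j, {ω | 1 < |X j ω|}) +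
        μ {ω | ENNReal.ofReal (ε ^ 2) ≤ liminf (fun N => F N ω) atTop} :=
        (measure_mono_ae hsub).trans (measure_union_le _ _)
    _ ≤ ENNReal.ofReal (∑' j, μ.real {ω | 1 < |X j ω|}) +
        ENNReal.ofReal K / ENNReal.ofReal (ε ^ 2) := by
        gcongr
        · rw [ENNReal.ofReal_tsum_of_nonneg (fun j => measureReal_nonneg) h₁]
          have : ∀ j, ENNReal.ofReal (μ.real {ω | 1 < |X j ω|}) = μ {ω | 1 < |X j ω|} :=
            fun j => ofReal_measureReal
          simp_rw [this]
          exact measure_iUnion_le _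
        · refine (meas_ge_le_lintegral_div (Measurable.liminf hFm).aemeasurable ?_ ?_).trans ?_
          · exact (ENNReal.ofReal_pos.2 (by positivity)).ne'
          · exact ENNReal.ofReal_ne_top
          · gcongr
            refine (lintegral_liminf_le hFm).trans ?_
            refine liminf_le_of_le (by isBoundedDefault) fun b hb => ?_
            obtain ⟨N, hN⟩ := hb.exists
            exact hN.trans (hFint N)
    _ = _ := by
        rw [← ENNReal.ofReal_div_of_pos (by positivity), ← ENNReal.ofReal_add
          (tsum_nonneg fun j => measureReal_nonneg) (by positivity)]

end Series

/-! ### Characteristic functions of series -/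

section SeriesCharFun

variable {Ω : Type*} [MeasurableSpace Ω] {μ : Measure Ω}

lemma aemeasurable_of_hasSum_conditional {X : ℤ → Ω → ℝ} (hX : ∀ j, Measurable (X j)) {V : Ω → ℝ}
    (hV : ∀ᵐ ω ∂μ, HasSum (fun j => X j ω) (V ω) (SummationFilter.conditional ℤ)) :
    AEMeasurable V μ :=
  aemeasurable_of_tendsto_metrizable_ae atTop
    (fun N : ℕ => (Finset.measurable_sum (Finset.Icc (-(N : ℤ)) N)
      fun j _ => hX j).aemeasurable)
    (hV.mono fun _ hω => hω.tendsto_sum_Icc_neg)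

variable [IsProbabilityMeasure μ]

/-- The characteristic function of the sum of a series of independent variables is dominated by
any finite part of the product of the characteristic functions of the terms. -/
lemma norm_charFun_series_sq_le {X : ℤ → Ω → ℝ} (hX : ∀ j, Measurable (X j))
    (hind : iIndepFun X μ) {V : Ω → ℝ}
    (hV : ∀ᵐ ω ∂μ, HasSum (fun j => X j ω) (V ω) (SummationFilter.conditional ℤ))
    (u : ℝ) (J : Finset ℤ) :
    ‖charFun (μ.map V) u‖ ^ 2 ≤
      Real.exp (-∑ j ∈ J, (1 - ‖charFun (μ.map (X j)) u‖ ^ 2)) := by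
  have hVm := aemeasurable_of_hasSum_conditional hX hV
  set S : ℕ → Ω → ℝ := fun N ω => ∑ j ∈ Finset.Icc (-(N : ℤ)) N, X j ω with hS
  have hSm : ∀ N, Measurable (S N) := fun N => Finset.measurable_sum _ fun j _ => hX j
  have hint : ∀ W : Ω → ℝ, AEMeasurable W μ →
      charFun (μ.map W) u = ∫ ω, Complex.exp (u * W ω * Complex.I) ∂μ := by
    intro W hW
    rw [charFun_apply_real, integral_map hW (by fun_prop)]
  have hlim : Tendsto (fun N => charFun (μ.map (S N)) u) atTop (𝓝 (charFun (μ.map V) u)) := by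
    rw [hint V hVm]
    simp_rw [fun N => hint (S N) (hSm N).aemeasurable]
    refine tendsto_integral_of_dominated_convergence (fun _ => 1)
      (fun N => ?_) (integrable_const _) (fun N => Eventually.of_forall fun ω => ?_) ?_
    · have := hSm N
      exact (by fun_prop : Measurable _).aestronglyMeasurable
    · have := Complex.norm_exp_ofReal_mul_I (u * S N ω)
      push_cast at this
      exact this.le
    · filter_upwards [hV] with ω hω
      have hc : Continuous fun x : ℝ => Complex.exp (u * x * Complex.I) := by fun_prop
      exact (hc.tendsto (V ω)).comp hω.tendsto_sum_Icc_neg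
  have ha : ∀ j, 0 ≤ 1 - ‖charFun (μ.map (X j)) u‖ ^ 2 := fun j => by
    have := Measure.isProbabilityMeasure_map (μ := μ) (hX j).aemeasurable
    have h1 := pow_le_one₀ (n := 2) (norm_nonneg _) (norm_charFun_le_one (μ := μ.map (X j)) u)
    linarith
  refine le_of_tendsto (hlim.norm.pow 2) ?_
  have hJ : ∀ᶠ N : ℕ in atTop, J ⊆ Finset.Icc (-(N : ℤ)) N := by
    filter_upwards [eventually_ge_atTop (J.sup Int.natAbs)] with N hN j hj
    have := (Finset.le_sup (f := Int.natAbs) hj).trans hN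
    rw [Finset.mem_Icc]
    omega
  filter_upwards [hJ] with N hN
  have hprod : charFun (μ.map (S N)) u =
      ∏ j ∈ Finset.Icc (-(N : ℤ)) N, charFun (μ.map (X j)) u := by
    have := congrFun ((hind.restrict (Finset.Icc (-(N : ℤ)) N)).charFun_map_fun_finsetSum_eq_prod
      fun j _ => (hX j).aemeasurable) u
    rwa [Finset.prod_apply] at this
  rw [hprod, norm_prod, ← Finset.prod_pow]
  calc ∏ j ∈ Finset.Icc (-(N : ℤ)) N, ‖charFun (μ.map (X j)) u‖ ^ 2
      ≤ ∏ j ∈ Finset.Icc (-(N : ℤ)) N,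
          Real.exp (-(1 - ‖charFun (μ.map (X j)) u‖ ^ 2)) := by
        refine Finset.prod_le_prod (fun j _ => sq_nonneg _) fun j _ => ?_
        have := Real.add_one_le_exp (-(1 - ‖charFun (μ.map (X j)) u‖ ^ 2))
        linarith
    _ = Real.exp (-∑ j ∈ Finset.Icc (-(N : ℤ)) N, (1 - ‖charFun (μ.map (X j)) u‖ ^ 2)) := by
        rw [← Real.exp_sum, Finset.sum_neg_distrib]
    _ ≤ _ := by
        refine Real.exp_le_exp.2 (neg_le_neg ?_)
        exact Finset.sum_le_sum_of_subset_of_nonneg hN fun j _ _ => ha j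

lemma one_sub_norm_charFun_le {V : Ω → ℝ} (hV : AEMeasurable V μ) {u : ℝ} (hu : |u| ≤ 1)
    {η : ℝ} (hη : 0 < η) :
    1 - ‖charFun (μ.map V) u‖ ≤ η + 2 * μ.real {ω | η ≤ |V ω|} := by
  have hE : NullMeasurableSet {ω | η ≤ |V ω|} μ :=
    nullMeasurableSet_le aemeasurable_const (by simpa using hV.norm)
  have hexp : Integrable (fun ω => Complex.exp (u * V ω * Complex.I)) μ := by
    refine Integrable.of_bound (by fun_prop) 1 (Eventually.of_forall fun ω => ?_)
    have := Complex.norm_exp_ofReal_mul_I (u * V ω)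
    push_cast at this
    exact this.le
  have hpt : ∀ ω, ‖1 - Complex.exp (u * V ω * Complex.I)‖ ≤
      η + {ω | η ≤ |V ω|}.indicator (fun _ => (2 : ℝ)) ω := by
    intro ω
    by_cases hω : ω ∈ {ω | η ≤ |V ω|}
    · rw [indicator_of_mem hω]
      have h1 := Complex.norm_exp_ofReal_mul_I (u * V ω)
      push_cast at h1
      have h2 := norm_sub_le (1 : ℂ) (Complex.exp (u * V ω * Complex.I))
      rw [h1, norm_one] at h2
      linarith
    · rw [indicator_of_notMem hω, add_zero, norm_sub_rev]
      have h1 := Real.norm_exp_I_mul_ofReal_sub_one_le (x := u * V ω)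
      rw [mul_comm] at h1
      push_cast at h1
      refine h1.trans ?_
      rw [norm_mul, Real.norm_eq_abs, Real.norm_eq_abs]
      have h2 : |V ω| < η := not_le.1 hω
      nlinarith [abs_nonneg u, abs_nonneg (V ω)]
  have hind : Integrable ({ω | η ≤ |V ω|}.indicator (fun _ => (2 : ℝ))) μ :=
    (integrable_const (2 : ℝ)).indicator₀ hE
  have h1 : 1 - charFun (μ.map V) u = ∫ ω, (1 - Complex.exp (u * V ω * Complex.I)) ∂μ := by
    rw [charFun_apply_real, integral_map hV (by fun_prop), integral_sub (integrable_const _) hexp]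
    simp
  calc 1 - ‖charFun (μ.map V) u‖ ≤ ‖1 - charFun (μ.map V) u‖ := by
        simpa using norm_sub_norm_le (1 : ℂ) (charFun (μ.map V) u)
    _ ≤ ∫ ω, ‖1 - Complex.exp (u * V ω * Complex.I)‖ ∂μ := by
        rw [h1]
        exact norm_integral_le_integral_norm _
    _ ≤ ∫ ω, (η + {ω | η ≤ |V ω|}.indicator (fun _ => (2 : ℝ)) ω) ∂μ :=
        integral_mono ((integrable_const _).sub hexp).norm ((integrable_const _).add hind) hpt
    _ = η + 2 * μ.real {ω | η ≤ |V ω|} := by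
        rw [integral_add (integrable_const _) hind, integral_indicator₀ hE]
        simp [mul_comm]

/-- If the sum of a series of independent variables is close to `0` in probability, then the
characteristic functions of the terms are collectively close to `1` in modulus on `[-1, 1]`. -/
lemma sum_one_sub_norm_charFun_sq_le {X : ℤ → Ω → ℝ} (hX : ∀ j, Measurable (X j))
    (hind : iIndepFun X μ) {V : Ω → ℝ}
    (hV : ∀ᵐ ω ∂μ, HasSum (fun j => X j ω) (V ω) (SummationFilter.conditional ℤ))
    {η s : ℝ} (hη : 0 < η) (hs : η + 2 * μ.real {ω | η ≤ |V ω|} ≤ s) (hs4 : s ≤ 1 / 4)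
    {u : ℝ} (hu : |u| ≤ 1) (J : Finset ℤ) :
    ∑ j ∈ J, (1 - ‖charFun (μ.map (X j)) u‖ ^ 2) ≤ 4 * s := by
  have h1 := (one_sub_norm_charFun_le (aemeasurable_of_hasSum_conditional hX hV) hu hη).trans hs
  have h2 := norm_charFun_series_sq_le hX hind hV u J
  set A := ∑ j ∈ J, (1 - ‖charFun (μ.map (X j)) u‖ ^ 2)
  have hs0 : 0 ≤ s := by
    have : 0 ≤ μ.real {ω | η ≤ |V ω|} := measureReal_nonneg
    linarith
  have h3 : 1 - 2 * s ≤ Real.exp (-A) := by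
    nlinarith [norm_nonneg (charFun (μ.map V) u)]
  have h4 : Real.exp A * Real.exp (-A) = 1 := by rw [← Real.exp_add]; simp
  have h5 := Real.add_one_le_exp A
  have h6 := Real.exp_pos A
  -- `(1 + A) (1 - 2 s) ≤ 1`, and `1 - 2 s ≥ 1 / 2`
  have h7 : Real.exp A * (1 - 2 * s) ≤ 1 := by
    exact (mul_le_mul_of_nonneg_left h3 h6.le).trans_eq h4
  have h8 : (A + 1) * (1 - 2 * s) ≤ 1 := (by gcongr; linarith : _ ≤ _).trans h7
  nlinarith

end SeriesCharFun

/-! ### Weighted series of variables with a common law -/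

section Weighted

variable {Ω : Type*} [MeasurableSpace Ω] {μ : Measure Ω}
  {ν : Measure ℝ} {Y : ℤ → Ω → ℝ}

lemma measureReal_one_lt_abs_mul_eq {Z : Ω → ℝ} (hZ : Measurable Z) (hlaw : μ.map Z = ν) (t : ℝ) :
    μ.real {ω | 1 < |t * Z ω|} = scaledTail ν t := by
  have hm : MeasurableSet {y : ℝ | 1 < |t * y|} :=
    measurableSet_lt measurable_const (by fun_prop)
  rw [scaledTail, ← hlaw, map_measureReal_apply hZ hm]
  rfl

lemma integral_truncOne_comp_eq {Z : Ω → ℝ} (hZ : Measurable Z) (hlaw : μ.map Z = ν) (t : ℝ) :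
    ∫ ω, truncOne (t * Z ω) ∂μ = ∫ y, truncOne (t * y) ∂ν := by
  have hm : Measurable fun y => truncOne (t * y) :=
    measurable_truncOne.comp (measurable_const_mul t)
  rw [← hlaw, integral_map hZ.aemeasurable hm.aestronglyMeasurable]

lemma integral_truncOne_sq_comp_eq {Z : Ω → ℝ} (hZ : Measurable Z) (hlaw : μ.map Z = ν) (t : ℝ) :
    ∫ ω, truncOne (t * Z ω) ^ 2 ∂μ = ∫ y, |truncOne (t * y)| ^ 2 ∂ν := by
  have hm : Measurable fun y => |truncOne (t * y)| ^ 2 :=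
    (measurable_truncOne.comp (measurable_const_mul t)).abs.pow_const 2
  rw [← hlaw, integral_map hZ.aemeasurable hm.aestronglyMeasurable]
  simp_rw [sq_abs]

lemma iIndepFun_const_mul (hind : iIndepFun Y μ) (c : ℤ → ℝ) :
    iIndepFun (fun j ω => c j * Y j ω) μ :=
  hind.comp (fun j x => c j * x) fun j => measurable_const_mul (c j)

/-- The data shared by the two directions of the criterion: independent variables `Y j` with common
law `ν`, whose truncated means and second moments are dominated by the tail at every scale. -/
structure IsTailDominated (μ : Measure Ω) (ν : Measure ℝ) (Y : ℤ → Ω → ℝ) (K : ℝ) : Prop where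
  measurable : ∀ j, Measurable (Y j)
  indep : iIndepFun Y μ
  law : ∀ j, μ.map (Y j) = ν
  mean_le : ∀ t, |∫ y, truncOne (t * y) ∂ν| ≤ K * scaledTail ν t
  sq_le : ∀ t, ∫ y, |truncOne (t * y)| ^ 2 ∂ν ≤ K * scaledTail ν t

namespace IsTailDominated

variable {K : ℝ} {c : ℤ → ℝ}

lemma summable_mean (hY : IsTailDominated μ ν Y K) (hc : Summable fun j => scaledTail ν (c j)) :
    Summable fun j => |∫ ω, truncOne (c j * Y j ω) ∂μ| := by
  refine (hc.mul_left K).of_nonneg_of_le (fun j => abs_nonneg _) fun j => ?_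
  rw [integral_truncOne_comp_eq (hY.measurable j) (hY.law j)]
  exact hY.mean_le _

lemma summable_sq (hY : IsTailDominated μ ν Y K) (hc : Summable fun j => scaledTail ν (c j)) :
    Summable fun j => ∫ ω, truncOne (c j * Y j ω) ^ 2 ∂μ := by
  refine (hc.mul_left K).of_nonneg_of_le
    (fun j => integral_nonneg fun ω => sq_nonneg _) fun j => ?_
  rw [integral_truncOne_sq_comp_eq (hY.measurable j) (hY.law j)]
  exact hY.sq_le _

lemma summable_tail (hY : IsTailDominated μ ν Y K) (hc : Summable fun j => scaledTail ν (c j)) :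
    Summable fun j => μ.real {ω | 1 < |c j * Y j ω|} := by
  simpa only [fun j => measureReal_one_lt_abs_mul_eq (hY.measurable j) (hY.law j) (c j)] using hc

variable [IsProbabilityMeasure μ]

lemma ae_hasSum (hY : IsTailDominated μ ν Y K) (hc : Summable fun j => scaledTail ν (c j)) :
    ∀ᵐ ω ∂μ, HasSum (fun j => c j * Y j ω) (linearSeries c Y ω)
      (SummationFilter.conditional ℤ) := by
  filter_upwards [ae_summable_conditional_of_three_series
    (fun j => (hY.measurable j).const_mul (c j)) (iIndepFun_const_mul hY.indep c)
    (hY.summable_tail hc) (hY.summable_mean hc) (hY.summable_sq hc)] with ω hω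
  exact hω.hasSum

lemma measure_le_abs_linearSeries_le (hY : IsTailDominated μ ν Y K)
    (hc : Summable fun j => scaledTail ν (c j)) {ε : ℝ} (hε : 0 < ε) :
    μ {ω | ε ≤ |linearSeries c Y ω|} ≤ ENNReal.ofReal (∑' j, scaledTail ν (c j) +
      (K * ∑' j, scaledTail ν (c j) + (K * ∑' j, scaledTail ν (c j)) ^ 2) / ε ^ 2) := by
  refine (measure_le_abs_series_le (fun j => (hY.measurable j).const_mul (c j))
    (iIndepFun_const_mul hY.indep c) (hY.summable_tail hc) (hY.summable_mean hc)
    (hY.summable_sq hc) (hY.ae_hasSum hc) hε).trans (ENNReal.ofReal_le_ofReal ?_)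
  rw [← tsum_mul_left]
  gcongr ?_ + (?_ + ?_ ^ 2) / _
  · simp_rw [fun j => measureReal_one_lt_abs_mul_eq (hY.measurable j) (hY.law j) (c j)]
    exact le_rfl
  · refine (hY.summable_sq hc).tsum_le_tsum (fun j => ?_) (hc.mul_left K)
    rw [integral_truncOne_sq_comp_eq (hY.measurable j) (hY.law j)]
    exact hY.sq_le _
  · refine (hY.summable_mean hc).tsum_le_tsum (fun j => ?_) (hc.mul_left K)
    rw [integral_truncOne_comp_eq (hY.measurable j) (hY.law j)]
    exact hY.mean_le _

lemma tendstoInMeasure_of_tendsto (hY : IsTailDominated μ ν Y K) {c : ℕ → ℤ → ℝ}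
    (hc : ∀ n, Summable fun j => scaledTail ν (c n j))
    (h : Tendsto (fun n => ∑' j, scaledTail ν (c n j)) atTop (𝓝 0)) :
    TendstoInMeasure μ (fun n => linearSeries (c n) Y) atTop (fun _ => (0 : ℝ)) := by
  rw [tendstoInMeasure_iff_norm]
  intro ε hε
  simp only [sub_zero, Real.norm_eq_abs]
  have hlim : Tendsto (fun n => ENNReal.ofReal (∑' j, scaledTail ν (c n j) +
      (K * ∑' j, scaledTail ν (c n j) + (K * ∑' j, scaledTail ν (c n j)) ^ 2) / ε ^ 2))
      atTop (𝓝 0) := by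
    have := ENNReal.tendsto_ofReal
      (h.add (((h.const_mul K).add ((h.const_mul K).pow 2)).div_const (ε ^ 2)))
    simpa using this
  exact tendsto_of_tendsto_of_tendsto_of_le_of_le tendsto_const_nhds hlim (fun _ => zero_le)
    fun n => hY.measure_le_abs_linearSeries_le (hc n) hε

lemma tendsto_of_tendstoInMeasure [IsProbabilityMeasure ν] {α : ℝ} (hα : 0 < α)
    (hν : HasTailIndex ν α) (hY : IsTailDominated μ ν Y K) {c : ℕ → ℤ → ℝ}
    (hc : ∀ n, Summable fun j => scaledTail ν (c n j))
    (h : TendstoInMeasure μ (fun n => linearSeries (c n) Y) atTop (fun _ => (0 : ℝ))) :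
    Tendsto (fun n => ∑' j, scaledTail ν (c n j)) atTop (𝓝 0) := by
  obtain ⟨κ, t₀, hκ, ht₀, hle⟩ := hν.scaledTail_le_one_sub_norm_charFun_sq hα
  have hp0 : 0 < scaledTail ν t₀ := by
    rw [scaledTail_eq_absTail ν ht₀.ne']
    exact hν.pos _ (by positivity)
  have habs : ∀ t, scaledTail ν |t| = scaledTail ν t := fun t => by
    simp only [scaledTail, abs_mul, abs_abs]
  rw [tendstoInMeasure_iff_measureReal_norm] at h
  simp only [sub_zero, Real.norm_eq_abs] at h
  have hnn : ∀ n, 0 ≤ ∑' j, scaledTail ν (c n j) := fun n =>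
    tsum_nonneg fun j => scaledTail_nonneg _ _
  refine Metric.tendsto_nhds.2 fun δ hδ => ?_
  -- the three entries serve, in turn, the exponential bound, the exclusion of coefficients
  -- beyond `t₀`, and the target accuracy
  set s := min (1 / 4) (min (κ * scaledTail ν t₀ / 8) (κ * δ / 8)) with hs
  have hs0 : 0 < s := by positivity
  have hs1 : s ≤ 1 / 4 := min_le_left _ _
  have hs2 : s ≤ κ * scaledTail ν t₀ / 8 := (min_le_right _ _).trans (min_le_left _ _)
  have hs3 : s ≤ κ * δ / 8 := (min_le_right _ _).trans (min_le_right _ _)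
  filter_upwards [(h (s / 2) (half_pos hs0)).eventually_le_const
    (by positivity : (0 : ℝ) < s / 4)] with n hn
  have key : ∀ u : ℝ, |u| ≤ 1 → ∀ J : Finset ℤ,
      ∑ j ∈ J, (1 - ‖charFun ν (u * c n j)‖ ^ 2) ≤ 4 * s := by
    intro u hu J
    have := sum_one_sub_norm_charFun_sq_le (fun j => (hY.measurable j).const_mul (c n j))
      (iIndepFun_const_mul hY.indep (c n)) (hY.ae_hasSum (hc n)) (half_pos hs0)
      (by linarith) hs1 hu J
    refine (Finset.sum_congr rfl fun j _ => ?_).trans_le this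
    rw [charFun_map_mul_comp (hY.measurable j).aemeasurable, hY.law, mul_comm]
  have hsmall : ∀ j, |c n j| ≤ t₀ := by
    intro j
    by_contra hj
    rw [not_le] at hj
    have hcj : 0 < |c n j| := ht₀.trans hj
    have hu : |t₀ * |c n j|⁻¹| ≤ 1 := by
      rw [abs_of_pos (by positivity), ← div_eq_mul_inv, div_le_one hcj]
      exact hj.le
    -- rescaling by `u ≤ 1` brings the coefficient to exactly `t₀` in modulus
    have habs' : |t₀ * |c n j|⁻¹ * c n j| = t₀ := by
      rw [abs_mul, abs_mul, abs_inv, abs_abs, abs_of_pos ht₀]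
      field_simp
    have h1 := key _ hu {j}
    rw [Finset.sum_singleton] at h1
    have h2 := hle _ habs'.le
    rw [← habs, habs'] at h2
    have : 0 < κ * scaledTail ν t₀ := by positivity
    linarith
  have hsum : ∑' j, scaledTail ν (c n j) ≤ δ / 2 := by
    refine (hc n).tsum_le_of_sum_le fun J => ?_
    have h1 := key 1 (by simp) J
    simp only [one_mul] at h1
    have h2 : κ * ∑ j ∈ J, scaledTail ν (c n j) ≤ κ * (δ / 2) := by
      rw [Finset.mul_sum]
      refine (Finset.sum_le_sum fun j _ => hle _ (hsmall j)).trans (h1.trans ?_)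
      linarith
    exact le_of_mul_le_mul_left h2 hκ
  rw [Real.dist_eq, sub_zero, abs_of_nonneg (hnn n)]
  linarith

end IsTailDominated

end Weighted

/-! ### The criterion -/

/-- A law whose two-sided tail is `x ^ (-α) * h x` with `h` slowly varying has tail index `α`. -/
lemma hasTailIndex_of_slowlyVarying {ν : Measure ℝ} [IsProbabilityMeasure ν] {α : ℝ} {h : ℝ → ℝ}
    (hslow : SlowlyVaryingAtTop h) (htail : ∀ x, 0 < x → absTail ν x = x ^ (-α) * h x) :
    HasTailIndex ν α := by
  obtain ⟨⟨X, hpos, -⟩, hratio⟩ := hslow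
  refine ⟨fun x hx => ?_, ?_⟩
  · have hz : 0 < max x X := lt_max_of_lt_left hx
    refine lt_of_lt_of_le ?_ (absTail_antitone (le_max_left x X))
    rw [htail _ hz]
    exact mul_pos (Real.rpow_pos_of_pos hz _) (hpos _ (le_max_right x X))
  · have := (hratio 2 two_pos).const_mul ((2 : ℝ) ^ (-α))
    rw [mul_one] at this
    refine this.congr' ?_
    filter_upwards [eventually_gt_atTop 0] with x hx
    rw [htail _ (by positivity), htail _ hx, Real.mul_rpow zero_le_two hx.le]
    have : x ^ (-α) ≠ 0 := (Real.rpow_pos_of_pos hx _).ne'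
    rw [mul_assoc, mul_div_assoc, mul_div_mul_left _ _ this]

theorem mainTheorem9 {Ω : Type*} [MeasurableSpace Ω] (μ : Measure Ω) [IsProbabilityMeasure μ]
    (α : ℝ) (hα0 : 0 < α) (hα2 : α < 2)
    (h : ℝ → ℝ) (hslow : SlowlyVaryingAtTop h)
    (Y : ℤ → Ω → ℝ) (hmeas : ∀ j, Measurable (Y j))
    (hindep : iIndepFun Y μ) (hident : ∀ j, IdentDistrib (Y j) (Y 0) μ μ)
    (htail : ∀ j, ∀ x : ℝ, 0 < x → μ.real {ω | x < |Y j ω|} = x ^ (-α) * h x)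
    (hmean : 1 < α → ∀ j, ∫ ω, Y j ω ∂μ = 0)
    (hsymm : α = 1 → ∀ j, IdentDistrib (fun ω => -Y j ω) (Y j) μ μ)
    (c : ℕ → ℤ → ℝ)
    (hc : ∀ n, Summable (fun j : ℤ => |c n j| ^ α * h (|c n j|⁻¹))) :
    (∀ n, ∀ᵐ ω ∂μ, Summable (fun j : ℤ => c n j * Y j ω) (SummationFilter.conditional ℤ)) ∧
    (TendstoInMeasure μ (fun n => linearSeries (c n) Y) atTop (fun _ => (0 : ℝ)) ↔
      Tendsto (fun n => ∑' j : ℤ, |c n j| ^ α * h (|c n j|⁻¹)) atTop (𝓝 0)) := by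
  set ν := μ.map (Y 0) with hνdef
  have hprob : IsProbabilityMeasure ν := Measure.isProbabilityMeasure_map (hmeas 0).aemeasurable
  have hT : ∀ x, 0 < x → absTail ν x = x ^ (-α) * h x := fun x hx => by
    rw [← htail 0 x hx, absTail, map_measureReal_apply (hmeas 0) (measurableSet_lt_abs x)]
    rfl
  have hν : HasTailIndex ν α := hasTailIndex_of_slowlyVarying hslow hT
  -- the terms of the criterion are the probabilities that `|c n j * Y j|` exceeds `1`
  have hterm : ∀ t : ℝ, |t| ^ α * h (|t|⁻¹) = scaledTail ν t := by
    intro t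
    rcases eq_or_ne t 0 with rfl | ht
    · rw [scaledTail_zero, abs_zero, Real.zero_rpow hα0.ne', zero_mul]
    · rw [scaledTail_eq_absTail ν ht, hT _ (by positivity), Real.inv_rpow (abs_nonneg t),
        Real.rpow_neg (abs_nonneg t), inv_inv]
  have hmeanν : 1 < α → ∫ y, y ∂ν = 0 := fun h1 => by
    rw [integral_map (hmeas 0).aemeasurable (by fun_prop)]
    exact hmean h1 0
  have hsymmν : α = 1 → ν.map (fun y => -y) = ν := fun h1 => by
    rw [hνdef, Measure.map_map measurable_neg (hmeas 0)]
    exact (hsymm h1 0).map_eq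
  obtain ⟨K₁, h₁⟩ := hν.abs_integral_truncOne_le hmeanν hsymmν
  obtain ⟨K₂, h₂⟩ := hν.integral_abs_truncOne_pow_le two_ne_zero (by exact_mod_cast hα2)
  have hY : IsTailDominated μ ν Y (max K₁ K₂) :=
    { measurable := hmeas
      indep := hindep
      law := fun j => (hident j).map_eq
      mean_le := fun t => (h₁ t).trans
        (mul_le_mul_of_nonneg_right (le_max_left _ _) (scaledTail_nonneg _ _))
      sq_le := fun t => (h₂ t).trans
        (mul_le_mul_of_nonneg_right (le_max_right _ _) (scaledTail_nonneg _ _)) }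
  simp only [hterm] at hc ⊢
  exact ⟨fun n => (hY.ae_hasSum (hc n)).mono fun _ hω => hω.summable,
    hY.tendsto_of_tendstoInMeasure hα0 hν hc, hY.tendstoInMeasure_of_tendsto hc⟩
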